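/- Let $\mathfrak g$ be a finite-dimensional simple Lie algebra over $\mathbb C$, let $\mathcal G=\operatorname{Aut}(\mathfrak g)$ be its group of Lie algebra automorphisms and let $G$ be the identity component of $\mathcal G$ (the adjoint group). Let $\mathfrak h\subset\mathfrak g$ be a Cartan subalgebra, $T\subset G$ the maximal torus with Lie algebra $\mathfrak h$, $N$ the normalizer of $T$ in $G$ and $W=N/T$ the Weyl group. All groups of automorphisms act diagonally on $\mathfrak g\oplus\mathfrak g$. A pair $\mathbf e=(e_1,e_2)\in\mathfrak g\oplus\mathfrak g$ is called a principal nilpotent pair if $[e_1,e_2]=0$, the common centralizer of $e_1$ and $e_2$ in $\mathfrak g$ has dimension $\operatorname{rk}(\mathfrak g)$, and for all $t_1,t_2\in\mathbb C^*$ there is $g\in G$ with $g\cdot\mathbf e=(t_1e_1,t_2e_2)$. Let $\mathbf e$ be a principal nilpotent pair, and for $i=1,2$ let $\mathcal G^{e_i}=\{\gamma\in\mathcal G:\gamma(G\cdot e_i)=G\cdot e_i\}$. (It is known that $\mathcal G^{e_1}=\mathcal G^{e_2}$; the statement holds with either one.) Let $\mathcal G^{\mathbf e}$ be $\mathcal G^{e_1}$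 or $\mathcal G^{e_2}$, let $\overline{\mathcal O}_{\mathbf e}$ be the closure in $\mathfrak g\oplus\mathfrak g$ of the orbit $\mathcal G^{\mathbf e}\cdot\mathbf e$, with its reduced structure, and let $$\mathfrak D_{\mathbf e}=\mathbb C[\overline{\mathcal O}_{\mathbf e}\cap(\mathfrak h\oplus\mathfrak h)]=\mathbb C[\mathfrak g\oplus\mathfrak g]\big/\big(I(\overline{\mathcal O}_{\mathbf e})+I(\mathfrak h\oplus\mathfrak h)\big)$$ be the coordinate ring of the scheme-theoretic intersection inside $\mathfrak g\oplus\mathfrak g$. Then: 1. $\mathfrak D_{\mathbf e}$ is a finite-dimensional commutative $\mathbb C$-algebra. 2. The bigrading of $\mathbb C[\mathfrak g\oplus\mathfrak g]$ in which $f$ has bidegree $(a,b)\in\mathbb Z_{\ge0}^2$ if $f(zx,ty)=z^at^bf(x,y)$ for all $z,t\in\mathbb C^*$ and $x,y\in\mathfrak g$ induces a bigrading on $\mathfrak D_{\mathbf e}$: the images $\mathfrak D_{\mathbf e}^{a,b}$ of the bihomogeneous parts satisfy $\mathfrak D_{\mathbf e}=\bigoplus_{a,b}\mathfrak D_{\mathbf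 e}^{a,b}$, $1\in\mathfrak D_{\mathbf e}^{0,0}$ and $\mathfrak D_{\mathbf e}^{a,b}\,\mathfrak D_{\mathbf e}^{a',b'}\subset\mathfrak D_{\mathbf e}^{a+a',b+b'}$. 3. The action $(n\cdot f)(x,y)=f(n^{-1}x,n^{-1}y)$ of $N$ on $\mathbb C[\mathfrak g\oplus\mathfrak g]$ induces an action of $W=N/T$ on $\mathfrak D_{\mathbf e}$ by $\mathbb C$-algebra automorphisms, and each $w\in W$ maps every $\mathfrak D_{\mathbf e}^{a,b}$ onto itself. -/

import Mathlib

open scoped Pointwise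

noncomputable section

namespace NilpotentPair

/-! ### Affine algebraic geometry in a complex vector space -/

section Affine

variable {V : Type*} [AddCommGroup V] [Module ℂ V]

variable (V) in
/-- The affine coordinate ring `ℂ[V]` of a finite-dimensional complex vector space `V`: the
algebra of polynomial functions on `V`, generated by the linear functionals. -/
def coordRing : Subalgebra ℂ (V → ℂ) :=
  Algebra.adjoin ℂ (Set.range fun φ : Module.Dual ℂ V => (φ : V → ℂ))

/-- The ideal `I(X)` of the polynomial functions vanishing identically on `X`. -/
def vanishingIdeal (X : Set V) : Ideal (coordRing V) where
  carrier := {f | ∀ p ∈ X, f.1 p = 0}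
  add_mem' := by
    intro f g hf hg p hp
    simp [hf p hp, hg p hp]
  zero_mem' := by
    intro p _
    rfl
  smul_mem' := by
    intro c f hf p hp
    simp [hf p hp]

/-- The common zeros in `V` of an ideal of `ℂ[V]`. -/
def zeroLocus (I : Ideal (coordRing V)) : Set V :=
  {p | ∀ f ∈ I, f.1 p = 0}

/-- The Zariski closure of a subset of `V`. -/
def zariskiClosure (X : Set V) : Set V :=
  zeroLocus (vanishingIdeal X)

theorem comp_mem_coordRing (L : V →ₗ[ℂ] V) (f : coordRing V) :
    (fun p => f.1 (L p)) ∈ coordRing V := by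
  obtain ⟨f, hf⟩ := f
  refine Algebra.adjoin_induction
    (p := fun g _ => (fun p => g (L p)) ∈ coordRing V) ?_ ?_ ?_ ?_ hf
  · rintro _ ⟨φ, rfl⟩
    exact Algebra.subset_adjoin ⟨φ.comp L, rfl⟩
  · intro r
    exact (coordRing V).algebraMap_mem r
  · intro g h _ _ hg hh
    exact (coordRing V).add_mem hg hh
  · intro g h _ _ hg hh
    exact (coordRing V).mul_mem hg hh

/-- The pull-back `f ↦ f ∘ L` of polynomial functions along a linear map. -/
def pullback (L : V →ₗ[ℂ] V) : coordRing V →ₐ[ℂ] coordRing V where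
  toFun f := ⟨fun p => f.1 (L p), comp_mem_coordRing L f⟩
  map_one' := rfl
  map_mul' _ _ := rfl
  map_zero' := rfl
  map_add' _ _ := rfl
  commutes' _ := rfl

/-- The coordinate ring `ℂ[X ∩ Y] = ℂ[V] / (I(X) + I(Y))` of the scheme-theoretic intersection
in `V` of two closed subvarieties `X` and `Y` (with their reduced structures). -/
abbrev IntersectionRing (X Y : Set V) : Type _ :=
  coordRing V ⧸ (vanishingIdeal X ⊔ vanishingIdeal Y)

/-- The polynomial functions on `V ⊕ V` of bidegree `d = (a, b)`, that is, the functions with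
`f (z x, t y) = z ^ a t ^ b f (x, y)` for all `(z, t)` in the torus `ℂ* × ℂ*`. -/
def bihomogeneous (d : ℕ × ℕ) : Submodule ℂ (coordRing (V × V)) where
  carrier := {f | ∀ (z t : ℂˣ) (x y : V),
    f.1 ((z : ℂ) • x, (t : ℂ) • y) = (z : ℂ) ^ d.1 * (t : ℂ) ^ d.2 * f.1 (x, y)}
  add_mem' := by
    intro f g hf hg z t x y
    have h1 := hf z t x y
    have h2 := hg z t x y
    simp only [Subalgebra.coe_add, Pi.add_apply] at h1 h2 ⊢
    rw [h1, h2]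
    ring
  zero_mem' := by
    intro z t x y
    simp
  smul_mem' := by
    intro c f hf z t x y
    have h1 := hf z t x y
    simp only [Subalgebra.coe_smul, Pi.smul_apply, smul_eq_mul] at h1 ⊢
    rw [h1]
    ring

end Affine

/-! ### The adjoint group, its maximal tori and Weyl groups -/

section Groups

variable (𝔤 : Type*) [LieRing 𝔤] [LieAlgebra ℂ 𝔤]

/-- The group of all automorphisms of the Lie algebra `𝔤`, as a subgroup of `GL(𝔤)`. It acts on
`𝔤`, and diagonally on `𝔤 × 𝔤`. -/
def fullAut : Subgroup (𝔤 ≃ₗ[ℂ] 𝔤) where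
  carrier := {γ | ∀ x y : 𝔤, γ ⁅x, y⁆ = ⁅γ x, γ y⁆}
  mul_mem' := by
    intro γ δ hγ hδ x y
    simp only [LinearEquiv.mul_apply]
    rw [hδ, hγ]
  one_mem' := by
    intro x y
    rfl
  inv_mem' := by
    intro γ hγ x y
    apply γ.injective
    rw [hγ]
    simp only [← LinearEquiv.mul_apply, mul_inv_cancel, LinearEquiv.coe_one, id_eq]

/-- The matrix coefficients `φ (γ x)` of an automorphism `γ`. -/
def matrixCoeff (γ : fullAut 𝔤) (p : 𝔤 × Module.Dual ℂ 𝔤) : ℂ :=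
  p.2 (γ • p.1)

/-- The usual (Lie group) topology of `Aut(𝔤) ⊆ GL(𝔤)` for a finite-dimensional `𝔤`: the
coarsest one for which all matrix coefficients are continuous. -/
instance autTopology : TopologicalSpace (fullAut 𝔤) :=
  TopologicalSpace.induced (matrixCoeff 𝔤) inferInstance

theorem continuous_mul_left_aut (γ : fullAut 𝔤) : Continuous fun δ : fullAut 𝔤 => γ * δ := by
  refine continuous_induced_rng.2 (continuous_pi fun p => ?_)
  have h : Continuous (matrixCoeff 𝔤) := continuous_induced_dom
  exact (continuous_apply
    ((p.1, p.2.comp (γ : 𝔤 ≃ₗ[ℂ] 𝔤).toLinearMap) : 𝔤 × Module.Dual ℂ 𝔤)).comp h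

theorem mul_mem_connectedComponent {γ δ ε : fullAut 𝔤}
    (h : δ ∈ connectedComponent ε) : γ * δ ∈ connectedComponent (γ * ε) := by
  have h1 : IsPreconnected ((fun δ : fullAut 𝔤 => γ * δ) '' connectedComponent ε) :=
    isPreconnected_connectedComponent.image _ (continuous_mul_left_aut 𝔤 γ).continuousOn
  exact h1.subset_connectedComponent ⟨ε, mem_connectedComponent, rfl⟩ ⟨δ, h, rfl⟩

/-- The adjoint group `G`: the identity component of the group of all automorphisms of `𝔤`. -/
def adjointGroup : Subgroup (fullAut 𝔤) where
  carrier := connectedComponent 1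
  mul_mem' := by
    intro γ δ hγ hδ
    have h := mul_mem_connectedComponent 𝔤 (γ := γ) hδ
    rw [mul_one, ← connectedComponent_eq hγ] at h
    exact h
  one_mem' := mem_connectedComponent
  inv_mem' := by
    intro γ hγ
    have h := mul_mem_connectedComponent 𝔤 (γ := γ⁻¹) (connectedComponent_eq hγ ▸
      (mem_connectedComponent : (1 : fullAut 𝔤) ∈ connectedComponent 1))
    rw [mul_one, inv_mul_cancel] at h
    exact h

variable {𝔤}

/-- `γ = exp (ad h) = ∑ (ad h) ^ k / k !`, where the series converges coefficientwise (which for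
a finite-dimensional `𝔤` is convergence in `End(𝔤)`). -/
def IsExpAd (h : 𝔤) (γ : 𝔤 → 𝔤) : Prop :=
  ∀ (x : 𝔤) (φ : Module.Dual ℂ 𝔤),
    HasSum (fun k : ℕ => ((k.factorial : ℂ))⁻¹ * φ ((LieAlgebra.ad ℂ 𝔤 h ^ k) x)) (φ (γ x))

/-- The maximal torus `T ⊆ G` with Lie algebra `H`, for a Cartan subalgebra `H` of `𝔤`: the
connected subgroup generated by the `exp (ad h)` with `h ∈ H`. -/
def torus (H : LieSubalgebra ℂ 𝔤) : Subgroup (adjointGroup 𝔤) :=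
  Subgroup.closure {γ | ∃ h ∈ H, IsExpAd h fun x => γ • x}

/-- The normalizer `N` of the maximal torus in `G`. -/
abbrev torusNormalizer (H : LieSubalgebra ℂ 𝔤) : Subgroup (adjointGroup 𝔤) :=
  Subgroup.normalizer (torus H : Set (adjointGroup 𝔤))

/-- The Weyl group `W = N / T`. -/
abbrev WeylGroup (H : LieSubalgebra ℂ 𝔤) : Type _ :=
  torusNormalizer H ⧸ (torus H).subgroupOf (torusNormalizer H)

/-- The diagonal action of an automorphism `γ` on the polynomial functions on `𝔤 ⊕ 𝔤`:
`(γ f) (x, y) = f (γ⁻¹ x, γ⁻¹ y)`. -/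
def actOnFunctions (γ : fullAut 𝔤) : coordRing (𝔤 × 𝔤) →ₐ[ℂ] coordRing (𝔤 × 𝔤) :=
  pullback (LinearMap.prodMap (γ⁻¹ : fullAut 𝔤).1.toLinearMap (γ⁻¹ : fullAut 𝔤).1.toLinearMap)

/-- The subgroup of the full automorphism group consisting of the elements that leave the
`G`-orbit of `x` invariant. -/
def orbitStabilizer (x : 𝔤) : Subgroup (fullAut 𝔤) :=
  MulAction.stabilizer (fullAut 𝔤) (MulAction.orbit (adjointGroup 𝔤) x)

/-- Principal nilpotent pairs in `𝔤`. -/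
structure IsPrincipalNilpotentPair [FiniteDimensional ℂ 𝔤] (e : 𝔤 × 𝔤) : Prop where
  commute : ⁅e.1, e.2⁆ = 0
  finrank_centralizer :
    Module.finrank ℂ
      (LinearMap.ker (LieAlgebra.ad ℂ 𝔤 e.1) ⊓ LinearMap.ker (LieAlgebra.ad ℂ 𝔤 e.2) :
        Submodule ℂ 𝔤) = LieAlgebra.rank ℂ 𝔤
  exists_smul_eq : ∀ t₁ t₂ : ℂˣ, ∃ g : adjointGroup 𝔤,
    g • e = ((t₁ : ℂ) • e.1, (t₂ : ℂ) • e.2)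

/-- The closure in `𝔤 ⊕ 𝔤` of the orbit of `e` under the diagonal action of `K ⊆ Aut(𝔤)`. -/
def orbitClosure (K : Subgroup (fullAut 𝔤)) (e : 𝔤 × 𝔤) : Set (𝔤 × 𝔤) :=
  zariskiClosure (MulAction.orbit K e)

/-- The subspace `H ⊕ H` of `𝔤 ⊕ 𝔤`. -/
def doubled (H : LieSubalgebra ℂ 𝔤) : Set (𝔤 × 𝔤) :=
  {p | p.1 ∈ H ∧ p.2 ∈ H}

/-- The coordinate ring of the scheme-theoretic intersection, inside `𝔤 ⊕ 𝔤`, of the closure of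
the diagonal `K`-orbit of `e` with `H ⊕ H`. -/
abbrev DRing (H : LieSubalgebra ℂ 𝔤) (K : Subgroup (fullAut 𝔤)) (e : 𝔤 × 𝔤) : Type _ :=
  IntersectionRing (orbitClosure K e) (doubled H)

/-- The class in `DRing H K e` of a polynomial function on `𝔤 ⊕ 𝔤`. -/
abbrev DRing.mk (H : LieSubalgebra ℂ 𝔤) (K : Subgroup (fullAut 𝔤)) (e : 𝔤 × 𝔤) :
    coordRing (𝔤 × 𝔤) →ₐ[ℂ] DRing H K e :=
  Ideal.Quotient.mkₐ ℂ (vanishingIdeal (orbitClosure K e) ⊔ vanishingIdeal (doubled H))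

/-- The part of bidegree `d` of `DRing H K e`, induced by the bigrading of `ℂ[𝔤 ⊕ 𝔤]`. -/
abbrev DRing.part (H : LieSubalgebra ℂ 𝔤) (K : Subgroup (fullAut 𝔤)) (e : 𝔤 × 𝔤)
    (d : ℕ × ℕ) : Submodule ℂ (DRing H K e) :=
  (bihomogeneous d).map (DRing.mk H K e).toLinearMap

end Groups

end NilpotentPair

end

/-! Finiteness: the third axiom makes `e` conjugate to `2e`, so each component of a point on the
orbit is conjugate to its double. The coefficients of the characteristic polynomial of `ad` are
invariant, and all but the leading one are homogeneous of positive degree, so these lower ones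
vanish on the orbit and lie in its ideal. On `H ⊕ H`, every weight of `H` on `𝔤`, applied to either
component, is an eigenvalue of `ad` and satisfies the characteristic equation. Adding the two ideals
leaves only the leading term, so weights become nilpotent (`mk_linearFn_pow_eq_zero`). As weights
span the dual of `H`, finitely many nilpotents generate the ring.

Bigrading: the ideal is stable under `(x, y) ↦ (2x, 3y)`, and the bidegree `(a, b)` part lies in its
eigenspace for `2 ^ a * 3 ^ b`; these numbers are distinct.

Weyl action: `N` preserves `H` (`torusNormalizer_smul_mem`) and, since `G ≤ K`, also the orbit,
while `T` fixes `H` pointwise and so acts trivially modulo `I(H ⊕ H)`. Beyond this inclusion,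
nothing about `K` matters. -/

noncomputable section

namespace NilpotentPair

/-! ### Polynomial functions, finite quotients and bigradings -/

section Affine

variable {V : Type*} [AddCommGroup V] [Module ℂ V]

/-- A linear functional as a polynomial function. -/
def linearFn (φ : Module.Dual ℂ V) : coordRing V :=
  ⟨φ, Algebra.subset_adjoin ⟨φ, rfl⟩⟩

@[simp] theorem linearFn_apply (φ : Module.Dual ℂ V) (p : V) : (linearFn φ).1 p = φ p := rfl

theorem pullback_apply (L : V →ₗ[ℂ] V) (f : coordRing V) (p : V) :
    (pullback L f).1 p = f.1 (L p) := rfl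

/-- Evaluation of polynomial functions at a point. -/
def evalAt (p : V) : coordRing V →ₐ[ℂ] ℂ :=
  (Pi.evalAlgHom ℂ (fun _ : V => ℂ) p).comp (coordRing V).val

theorem mem_vanishingIdeal {X : Set V} {f : coordRing V} :
    f ∈ vanishingIdeal X ↔ ∀ p ∈ X, evalAt p f = 0 := Iff.rfl

theorem coordRing_induction {p : coordRing V → Prop}
    (linear : ∀ φ : Module.Dual ℂ V, p (linearFn φ))
    (const : ∀ r : ℂ, p (algebraMap ℂ (coordRing V) r))
    (add : ∀ f g, p f → p g → p (f + g)) (mul : ∀ f g, p f → p g → p (f * g))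
    (f : coordRing V) : p f := by
  obtain ⟨f, hf⟩ := f
  refine Algebra.adjoin_induction (p := fun g hg => p ⟨g, hg⟩) ?_ ?_ ?_ ?_ hf
  · rintro _ ⟨φ, rfl⟩
    exact linear φ
  · exact const
  · intro g h hg hh
    exact add ⟨g, hg⟩ ⟨h, hh⟩
  · intro g h hg hh
    exact mul ⟨g, hg⟩ ⟨h, hh⟩

theorem subalgebra_quotient_eq_top {J : Ideal (coordRing V)} {S : Subalgebra ℂ (coordRing V ⧸ J)}
    (h : ∀ φ : Module.Dual ℂ V, Ideal.Quotient.mkₐ ℂ J (linearFn φ) ∈ S) : S = ⊤ := by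
  rw [eq_top_iff]
  rintro x -
  obtain ⟨f, rfl⟩ := Ideal.Quotient.mkₐ_surjective ℂ J x
  induction f using coordRing_induction with
  | linear φ => exact h φ
  | const r =>
    rw [AlgHom.commutes]
    exact S.algebraMap_mem r
  | add f g hf hg => rw [map_add]; exact add_mem hf hg
  | mul f g hf hg => rw [map_mul]; exact mul_mem hf hg

/-- Nilpotent elements are integral, and an algebra generated by finitely many integral elements is
a finite module. -/
theorem finite_quotient_of_adjoin_eq_top {A : Type*} [CommRing A] [Algebra ℂ A] {J : Ideal A}
    {ι : Type*} [Finite ι] {u : ι → A ⧸ J} {N : ℕ} (hu : ∀ i, u i ^ N = 0)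
    (h : Algebra.adjoin ℂ (Set.range u) = ⊤) : Module.Finite ℂ (A ⧸ J) := by
  refine Module.finite_def.2 ?_
  have hfg := fg_adjoin_of_finite (R := ℂ) (Set.finite_range u) ?_
  · rw [h] at hfg
    exact hfg
  rintro _ ⟨i, rfl⟩
  exact ⟨Polynomial.X ^ N, Polynomial.monic_X_pow N, by rw [Polynomial.eval₂_X_pow, hu]⟩

/-- A quotient of `ℂ[V]` is finite-dimensional as soon as the linear functionals become polynomials
in finitely many nilpotent elements. -/
theorem finite_quotient_of_nilpotent_generators {J : Ideal (coordRing V)} {ι : Type*} [Finite ι]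
    {u : ι → coordRing V ⧸ J} {N : ℕ} (hu : ∀ i, u i ^ N = 0)
    (h : ∀ φ : Module.Dual ℂ V,
      Ideal.Quotient.mkₐ ℂ J (linearFn φ) ∈ Algebra.adjoin ℂ (Set.range u)) :
    Module.Finite ℂ (coordRing V ⧸ J) :=
  finite_quotient_of_adjoin_eq_top hu (subalgebra_quotient_eq_top h)

/-- Thanks to this, every condition on the orbit closure can be checked on the orbit itself. -/
theorem vanishingIdeal_zariskiClosure (X : Set V) :
    vanishingIdeal (zariskiClosure X) = vanishingIdeal X := by
  refine le_antisymm (fun f hf p hp => hf p fun g hg => hg p hp) fun f hf p hp => hp f hf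

theorem vanishingIdeal_le_comap_pullback {X : Set V} (L : V →ₗ[ℂ] V) (hL : ∀ p ∈ X, L p ∈ X) :
    vanishingIdeal X ≤ (vanishingIdeal X).comap (pullback L) :=
  fun _ hf p hp => hf (L p) (hL p hp)

/-- The coefficients of the characteristic polynomial of an endomorphism depending linearly on a
point of `V` are polynomial functions on `V`. -/
theorem charpoly_coeff_mem_coordRing [FiniteDimensional ℂ V] {M : Type*} [AddCommGroup M]
    [Module ℂ M] [FiniteDimensional ℂ M] (A : V →ₗ[ℂ] Module.End ℂ M) (k : ℕ) :
    (fun p => (LinearMap.charpoly (A p)).coeff k) ∈ coordRing V := by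
  let b := Module.finBasis ℂ V
  let F : coordRing V := MvPolynomial.aeval (fun i => linearFn (b.coord i))
    ((A.polyCharpoly b).coeff k)
  convert F.2 using 1
  funext p
  have h : evalAt p F = (LinearMap.charpoly (A p)).coeff k := by
    rw [← LinearMap.polyCharpoly_coeff_eval A b p k, ← MvPolynomial.coe_aeval_eq_eval]
    simp only [F, ← AlgHom.comp_apply, MvPolynomial.comp_aeval]
    rfl
  exact h.symm

/-- In coordinates of `V` the coefficient is a form of degree `finrank M - k`; `j` names this degree
without subtraction. -/
theorem charpoly_coeff_smul [FiniteDimensional ℂ V] {M : Type*} [AddCommGroup M]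
    [Module ℂ M] [FiniteDimensional ℂ M] (A : V →ₗ[ℂ] Module.End ℂ M) {k j : ℕ}
    (hkj : k + j = Module.finrank ℂ M) (t : ℂ) (p : V) :
    (LinearMap.charpoly (A (t • p))).coeff k = t ^ j * (LinearMap.charpoly (A p)).coeff k := by
  let b := Module.finBasis ℂ V
  have h := LinearMap.polyCharpoly_coeff_isHomogeneous A b k j hkj
  rw [← LinearMap.polyCharpoly_coeff_eval A b, ← LinearMap.polyCharpoly_coeff_eval A b,
    MvPolynomial.eval_eq, MvPolynomial.eval_eq, Finset.mul_sum]
  refine Finset.sum_congr rfl fun d hd => ?_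
  have hd' := h (MvPolynomial.mem_support_iff.1 hd)
  rw [Finsupp.weight_apply, Finsupp.sum] at hd'
  simp only [map_smul, Finsupp.smul_apply, smul_eq_mul, mul_pow, Finset.prod_mul_distrib,
    Finset.prod_pow_eq_pow_sum]
  have : ∑ i ∈ d.support, d i = j := by simpa using hd'
  rw [this]
  ring

theorem one_mem_bihomogeneous : (1 : coordRing (V × V)) ∈ bihomogeneous (V := V) 0 := by
  intro z t x y
  simp

theorem mul_mem_bihomogeneous {d d' : ℕ × ℕ} {f g : coordRing (V × V)}
    (hf : f ∈ bihomogeneous d) (hg : g ∈ bihomogeneous d') :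
    f * g ∈ bihomogeneous (d + d') := by
  intro z t x y
  have h1 := hf z t x y
  have h2 := hg z t x y
  simp only [MulMemClass.coe_mul, Pi.mul_apply, Prod.fst_add, Prod.snd_add] at h1 h2 ⊢
  rw [h1, h2]
  ring

/-- A linear functional splits into its restrictions to the two summands, of bidegrees `(1, 0)` and
`(0, 1)`; products of bihomogeneous functions are bihomogeneous. -/
theorem iSup_bihomogeneous : ⨆ d, bihomogeneous (V := V) d = ⊤ := by
  rw [eq_top_iff]
  rintro f -
  induction f using coordRing_induction with
  | linear φ =>
    have h : linearFn φ = linearFn (φ ∘ₗ LinearMap.inl ℂ V V ∘ₗ LinearMap.fst ℂ V V) +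
        linearFn (φ ∘ₗ LinearMap.inr ℂ V V ∘ₗ LinearMap.snd ℂ V V) := by
      ext p
      simp [← map_add]
    rw [h]
    refine add_mem (Submodule.mem_iSup_of_mem (1, 0) ?_) (Submodule.mem_iSup_of_mem (0, 1) ?_)
    · intro z t x y
      have : ((z : ℂ) • x, (0 : V)) = (z : ℂ) • (x, (0 : V)) := by simp
      simp [this, -Prod.smul_mk]
    · intro z t x y
      have : ((0 : V), (t : ℂ) • y) = (t : ℂ) • ((0 : V), y) := by simp
      simp [this, -Prod.smul_mk]
  | const r =>
    rw [Algebra.algebraMap_eq_smul_one]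
    exact Submodule.smul_mem _ _ (Submodule.mem_iSup_of_mem 0 one_mem_bihomogeneous)
  | add f g hf hg => exact add_mem hf hg
  | mul f g hf hg =>
    induction hf using Submodule.iSup_induction' with
    | zero => simp
    | add f f' _ _ h h' => rw [add_mul]; exact add_mem h h'
    | mem d f hf =>
      induction hg using Submodule.iSup_induction' with
      | zero => simp
      | add g g' _ _ h h' => rw [mul_add]; exact add_mem h h'
      | mem d' g hg => exact Submodule.mem_iSup_of_mem (d + d') (mul_mem_bihomogeneous hf hg)

/-- The linear map `(x, y) ↦ (z x, t y)`. -/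
def biscale (z t : ℂ) : V × V →ₗ[ℂ] V × V :=
  (z • LinearMap.id).prodMap (t • LinearMap.id)

/-- Unique factorization lets a single scaling operator separate all bidegrees. -/
theorem injective_two_pow_mul_three_pow :
    Function.Injective fun d : ℕ × ℕ => (2 : ℂ) ^ d.1 * 3 ^ d.2 := by
  rintro ⟨a, b⟩ ⟨a', b'⟩ h
  have h' : 2 ^ a * 3 ^ b = 2 ^ a' * 3 ^ b' := by
    simp only at h
    exact_mod_cast h
  have hcop : ∀ m n : ℕ, Nat.Coprime (2 ^ m) (3 ^ n) := fun m n =>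
    Nat.Coprime.pow m n (by norm_num)
  have h2 : 2 ^ a = 2 ^ a' := Nat.dvd_antisymm
    ((hcop a b').dvd_of_dvd_mul_right (h' ▸ Dvd.intro _ rfl))
    ((hcop a' b).dvd_of_dvd_mul_right (h'.symm ▸ Dvd.intro _ rfl))
  have h3 : 3 ^ b = 3 ^ b' := by
    rw [h2] at h'
    exact Nat.eq_of_mul_eq_mul_left (by positivity) h'
  exact Prod.ext (Nat.pow_right_injective le_rfl h2) (Nat.pow_right_injective (by norm_num) h3)

theorem iSupIndep_of_le_eigenspace {ι B : Type*} [AddCommGroup B] [Module ℂ B]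
    (σ : Module.End ℂ B) {μ : ι → ℂ} (hμ : Function.Injective μ) {p : ι → Submodule ℂ B}
    (hp : ∀ i, p i ≤ σ.eigenspace (μ i)) : iSupIndep p :=
  (σ.eigenspaces_iSupIndep.comp hμ).mono hp

/-- The bigrading of `ℂ[V ⊕ V]` induces a bigrading of its quotient by an ideal that is stable
under bi-scaling. -/
theorem isInternal_map_bihomogeneous (J : Ideal (coordRing (V × V)))
    (hJ : J ≤ J.comap (pullback (biscale 2 3))) :
    DirectSum.IsInternal fun d : ℕ × ℕ =>
      (bihomogeneous (V := V) d).map (Ideal.Quotient.mkₐ ℂ J).toLinearMap := by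
  rw [DirectSum.isInternal_submodule_iff_iSupIndep_and_iSup_eq_top]
  constructor
  · let σ : Module.End ℂ (coordRing (V × V) ⧸ J) := (Ideal.quotientMapₐ J _ hJ).toLinearMap
    refine iSupIndep_of_le_eigenspace σ injective_two_pow_mul_three_pow ?_
    rintro d _ ⟨f, hf, rfl⟩
    rw [Module.End.mem_eigenspace_iff]
    have h : pullback (biscale 2 3) f = ((2 : ℂ) ^ d.1 * 3 ^ d.2) • f := by
      ext ⟨x, y⟩
      exact hf (Units.mk0 2 two_ne_zero) (Units.mk0 3 three_ne_zero) x y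
    calc σ (Ideal.Quotient.mkₐ ℂ J f)
        = Ideal.Quotient.mkₐ ℂ J (pullback (biscale 2 3) f) := rfl
      _ = ((2 : ℂ) ^ d.1 * 3 ^ d.2) • Ideal.Quotient.mkₐ ℂ J f := by rw [h, map_smul]
  · rw [← Submodule.map_iSup, iSup_bihomogeneous, Submodule.map_top, LinearMap.range_eq_top]
    exact Ideal.Quotient.mkₐ_surjective ℂ J

end Affine

/-! ### Weight bases and exponentials of Cartan elements -/

section CartanEigenbasis

variable {𝔤 : Type*} [LieRing 𝔤] [LieAlgebra ℂ 𝔤]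

/-- A Cartan subalgebra of a Killing Lie algebra is simultaneously diagonalizable. -/
theorem exists_eigenbasis [FiniteDimensional ℂ 𝔤] [LieAlgebra.IsKilling ℂ 𝔤] (H : LieSubalgebra ℂ 𝔤)
    [H.IsCartanSubalgebra] :
    ∃ (n : ℕ) (b : Module.Basis (Fin n) ℂ 𝔤) (c : Fin n → Module.Dual ℂ H),
      ∀ (i : Fin n) (h : H), ⁅(h : 𝔤), b i⁆ = c i h • b i := by
  let S : Set 𝔤 := {v | ∃ χ : Module.Dual ℂ H, ∀ h : H, ⁅(h : 𝔤), v⁆ = χ h • v}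
  have hS : ⊤ ≤ Submodule.span ℂ S := by
    have h := LieModule.iSup_genWeightSpace_eq_top' ℂ H 𝔤
    rw [← LieSubmodule.toSubmodule_inj, LieSubmodule.iSup_toSubmodule,
      LieSubmodule.top_toSubmodule] at h
    rw [← h]
    -- For a Killing Lie algebra the generalized weight vectors are genuine eigenvectors.
    refine iSup_le fun χ v hv => Submodule.subset_span ⟨χ.toLinear, fun h => ?_⟩
    exact LieAlgebra.IsKilling.lie_eq_smul_of_mem_rootSpace hv h
  let b₀ := Module.Basis.ofSpan hS
  have : Finite _ := Module.Finite.finite_basis b₀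
  let b := b₀.reindex (Finite.equivFin _)
  have hb : ∀ i, b i ∈ S := fun i => by
    rw [Module.Basis.reindex_apply]
    exact Module.Basis.ofSpan_subset hS ⟨_, rfl⟩
  choose c hc using hb
  exact ⟨_, b, c, hc⟩

variable {H : LieSubalgebra ℂ 𝔤} {n : ℕ} (b : Module.Basis (Fin n) ℂ 𝔤)
  (c : Fin n → Module.Dual ℂ H)

/-- The automorphism multiplying the `i`-th basis vector by `exp (c i h)`. -/
def diagExp (h : H) : 𝔤 →ₗ[ℂ] 𝔤 :=
  b.constr ℂ fun i => Complex.exp (c i h) • b i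

@[simp] theorem diagExp_basis (h : H) (i : Fin n) :
    diagExp b c h (b i) = Complex.exp (c i h) • b i :=
  b.constr_basis ..

theorem diagExp_comp_neg (h : H) : diagExp b c h ∘ₗ diagExp b c (-h) = LinearMap.id := by
  refine b.ext fun i => ?_
  simp [smul_smul, ← Complex.exp_add]

theorem repr_diagExp (h : H) (x : 𝔤) (i : Fin n) :
    b.repr (diagExp b c h x) i = Complex.exp (c i h) * b.repr x i := by
  have : b.coord i ∘ₗ diagExp b c h = Complex.exp (c i h) • b.coord i := by
    refine b.ext fun j => ?_
    by_cases hij : i = j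
    · subst hij; simp
    · simp [Ne.symm hij]
  exact LinearMap.congr_fun this x

/-- `diagExp` as a linear automorphism. -/
def diagExpEquiv (h : H) : 𝔤 ≃ₗ[ℂ] 𝔤 :=
  LinearEquiv.ofLinearMap (diagExp b c h) (diagExp b c (-h)) (diagExp_comp_neg b c h)
    (by simpa using diagExp_comp_neg b c (-h))

variable {b c} (hbc : ∀ (i : Fin n) (h : H), ⁅(h : 𝔤), b i⁆ = c i h • b i)

include hbc

theorem repr_lie (h : H) (x : 𝔤) (i : Fin n) :
    b.repr ⁅(h : 𝔤), x⁆ i = c i h * b.repr x i := by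
  have : b.coord i ∘ₗ (LieAlgebra.ad ℂ 𝔤 (h : 𝔤)) = c i h • b.coord i := by
    refine b.ext fun j => ?_
    by_cases hij : i = j
    · subst hij; simp [hbc]
    · simp [hbc, Ne.symm hij]
  exact LinearMap.congr_fun this x

/-- By Leibniz, `⁅b i, b j⁆` has weight `c i + c j`. Hence each of its coordinates either vanishes
or belongs to a basis vector whose weight at `h` is that sum. -/
theorem diagExp_lie_basis (h : H) (i j : Fin n) :
    diagExp b c h ⁅b i, b j⁆ = ⁅diagExp b c h (b i), diagExp b c h (b j)⁆ := by
  have hlie : ⁅(h : 𝔤), ⁅b i, b j⁆⁆ = (c i h + c j h) • ⁅b i, b j⁆ := by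
    rw [leibniz_lie, hbc, hbc, smul_lie, lie_smul, add_smul]
  refine b.ext_elem fun k => ?_
  have hk : c k h * b.repr ⁅b i, b j⁆ k = (c i h + c j h) * b.repr ⁅b i, b j⁆ k := by
    rw [← repr_lie hbc, hlie]
    simp
  simp only [repr_diagExp, diagExp_basis, smul_lie, lie_smul, map_smul, Finsupp.smul_apply,
    smul_eq_mul]
  rw [← mul_assoc, ← Complex.exp_add, add_comm (c j h)]
  rcases mul_eq_mul_right_iff.1 hk with hk | hk
  · rw [hk]
  · rw [hk]; simp

theorem diagExpEquiv_mem_fullAut (h : H) : diagExpEquiv b c h ∈ fullAut 𝔤 := by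
  let B₁ : 𝔤 →ₗ[ℂ] 𝔤 →ₗ[ℂ] 𝔤 :=
    (LieModule.toEnd ℂ 𝔤 𝔤 : 𝔤 →ₗ[ℂ] Module.End ℂ 𝔤).compr₂ (diagExp b c h)
  let B₂ : 𝔤 →ₗ[ℂ] 𝔤 →ₗ[ℂ] 𝔤 :=
    (LieModule.toEnd ℂ 𝔤 𝔤 : 𝔤 →ₗ[ℂ] Module.End ℂ 𝔤).compl₁₂ (diagExp b c h) (diagExp b c h)
  have : B₁ = B₂ := b.ext fun i => b.ext fun j => diagExp_lie_basis hbc h i j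
  intro x y
  exact LinearMap.congr_fun (LinearMap.congr_fun this x) y

/-- The path `t ↦ exp (t ad h)`, `0 ≤ t ≤ 1`, joins the identity to this automorphism. -/
theorem diagExp_mem_adjointGroup (h : H) :
    (⟨diagExpEquiv b c h, diagExpEquiv_mem_fullAut hbc h⟩ : fullAut 𝔤) ∈ adjointGroup 𝔤 := by
  let γ : ℝ → fullAut 𝔤 := fun t =>
    ⟨diagExpEquiv b c ((t : ℂ) • h), diagExpEquiv_mem_fullAut hbc _⟩
  have hγ : Continuous γ := by
    refine continuous_induced_rng.2 (continuous_pi fun p => ?_)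
    have : (fun t : ℝ => p.2 (diagExp b c ((t : ℂ) • h) p.1)) =
        fun t : ℝ => ∑ i, b.repr p.1 i * (Complex.exp (t * c i h) * p.2 (b i)) := by
      funext t
      conv_lhs => rw [← b.sum_repr p.1]
      simp only [map_sum, map_smul, diagExp_basis, smul_eq_mul]
    change Continuous fun t : ℝ => p.2 (diagExp b c ((t : ℂ) • h) p.1)
    rw [this]
    fun_prop
  have h0 : γ 0 = 1 := by
    refine Subtype.ext (LinearEquiv.toLinearMap_injective (b.ext fun i => ?_))
    change diagExp b c (((0 : ℝ) : ℂ) • h) (b i) = b i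
    simp
  have h1 : γ 1 = ⟨diagExpEquiv b c h, diagExpEquiv_mem_fullAut hbc h⟩ := by
    simp [γ]
  have hc := (isPreconnected_range hγ).subset_connectedComponent ⟨0, h0⟩
  exact hc ⟨1, h1⟩

theorem isExpAd_diagExp (h : H) : IsExpAd (h : 𝔤) (diagExp b c h) := by
  intro x φ
  have hpow : ∀ k : ℕ, ∀ i, (LieAlgebra.ad ℂ 𝔤 (h : 𝔤) ^ k) (b i) = c i h ^ k • b i := by
    intro k i
    induction k with
    | zero => simp
    | succ k ih =>
      rw [pow_succ', Module.End.mul_apply, ih, map_smul, LieAlgebra.ad_apply, hbc, smul_smul,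
        pow_succ]
  have hsum : ∀ i, HasSum (fun k : ℕ => b.repr x i * φ (b i) * (c i h ^ k / (k.factorial : ℂ)))
      (b.repr x i * φ (b i) * Complex.exp (c i h)) := fun i => by
    rw [Complex.exp_eq_exp_ℂ]
    exact (NormedSpace.expSeries_div_hasSum_exp (c i h)).mul_left _
  have := hasSum_sum fun i (_ : i ∈ Finset.univ) => hsum i
  convert this using 1
  · funext k
    conv_lhs => rw [← b.sum_repr x]
    simp only [map_sum, map_smul, hpow, smul_eq_mul, Finset.mul_sum]
    refine Finset.sum_congr rfl fun i _ => ?_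
    ring
  · conv_lhs => rw [← b.sum_repr x]
    simp only [map_sum, map_smul, diagExp_basis, smul_eq_mul]
    refine Finset.sum_congr rfl fun i _ => ?_
    ring

omit hbc in
-- Only the `k = 0` term of the series survives, and linear functionals separate points.
theorem IsExpAd.apply_eq_self {h x : 𝔤} {γ : 𝔤 → 𝔤} (hγ : IsExpAd h γ) (hx : ⁅h, x⁆ = 0) :
    γ x = x := by
  rw [← sub_eq_zero, ← Module.forall_dual_apply_eq_zero_iff ℂ]
  intro φ
  rw [map_sub, sub_eq_zero]
  refine (hγ x φ).unique ?_
  convert hasSum_single (f := fun k : ℕ => ((k.factorial : ℂ))⁻¹ *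
    φ ((LieAlgebra.ad ℂ 𝔤 h ^ k) x)) 0 ?_ using 1
  · simp
  · intro k hk
    obtain ⟨k, rfl⟩ := Nat.exists_eq_succ_of_ne_zero hk
    simp [pow_succ, hx]

end CartanEigenbasis

/-! ### The torus and its normalizer acting on the Cartan subalgebra -/

section Torus

variable {𝔤 : Type*} [LieRing 𝔤] [LieAlgebra ℂ 𝔤] [FiniteDimensional ℂ 𝔤]
  [LieAlgebra.IsKilling ℂ 𝔤] {H : LieSubalgebra ℂ 𝔤} [H.IsCartanSubalgebra]

theorem lie_eq_zero_of_mem_cartan {x y : 𝔤} (hx : x ∈ H) (hy : y ∈ H) : ⁅x, y⁆ = 0 :=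
  congrArg Subtype.val (LieModule.IsTrivial.trivial (⟨x, hx⟩ : H) (⟨y, hy⟩ : H))

theorem torus_smul_eq_self {γ : adjointGroup 𝔤} (hγ : γ ∈ torus H) {x : 𝔤} (hx : x ∈ H) :
    γ • x = x := by
  induction hγ using Subgroup.closure_induction with
  | mem γ hγ =>
    obtain ⟨h, hh, hγ⟩ := hγ
    exact hγ.apply_eq_self (lie_eq_zero_of_mem_cartan hh hx)
  | one => exact one_smul _ x
  | mul γ δ _ _ hγ hδ => rw [mul_smul, hδ, hγ]
  | inv γ _ hγ => rw [inv_smul_eq_iff, hγ]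

omit [FiniteDimensional ℂ 𝔤] [LieAlgebra.IsKilling ℂ 𝔤] in
theorem fullAut_smul_lie (γ : fullAut 𝔤) (x y : 𝔤) : γ • ⁅x, y⁆ = ⁅γ • x, γ • y⁆ :=
  γ.2 x y

/-- The normalizer of the maximal torus leaves its Lie algebra invariant. -/
theorem torusNormalizer_smul_mem {γ : adjointGroup 𝔤} (hγ : γ ∈ torusNormalizer H) {x : 𝔤}
    (hx : x ∈ H) : γ • x ∈ H := by
  obtain ⟨n, b, c, hbc⟩ := exists_eigenbasis H
  -- Since `H` is self-normalizing, it is enough that `γ • x` commutes with `H`.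
  rw [← LieSubalgebra.IsCartanSubalgebra.self_normalizing (H := H),
    LieSubalgebra.mem_normalizer_iff]
  intro y hy
  suffices h : ⁅x, γ⁻¹ • y⁆ = 0 by
    have h' : ⁅γ • x, y⁆ = γ • ⁅x, γ⁻¹ • y⁆ := by
      have := fullAut_smul_lie γ.1 x (γ⁻¹ • y)
      refine Eq.trans ?_ this.symm
      exact congrArg (fun z => ⁅γ • x, z⁆) (smul_inv_smul γ y).symm
    rw [h', h, smul_zero]
    exact H.zero_mem
  -- For `δ = exp (t ad x)` the conjugate `γ δ γ⁻¹` lies in the torus and fixes `y`, so `δ` fixes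
  -- `γ⁻¹ • y`.
  have key : ∀ t : ℂ, diagExp b c (t • ⟨x, hx⟩) (γ⁻¹ • y) = γ⁻¹ • y := by
    intro t
    let δ : adjointGroup 𝔤 := ⟨_, diagExp_mem_adjointGroup hbc (t • ⟨x, hx⟩)⟩
    have hδ : δ ∈ torus H :=
      Subgroup.subset_closure ⟨_, (t • (⟨x, hx⟩ : H)).2, isExpAd_diagExp hbc _⟩
    have h := torus_smul_eq_self ((Subgroup.mem_normalizer_iff.1 hγ δ).1 hδ) hy
    rw [mul_smul, mul_smul, smul_eq_iff_eq_inv_smul] at h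
    exact h
  refine b.ext_elem fun i => ?_
  rw [repr_lie hbc ⟨x, hx⟩, map_zero, Finsupp.zero_apply, mul_eq_zero]
  by_contra! hne
  -- This `t` normalizes the exponent to `1`, which is not a period of `exp`.
  have h := congrArg (fun v => b.repr v i) (key (c i ⟨x, hx⟩)⁻¹)
  simp only [repr_diagExp, map_smul, smul_eq_mul, inv_mul_cancel₀ hne.1] at h
  have h1 : Complex.exp 1 = 1 := mul_right_cancel₀ hne.2 (h.trans (one_mul _).symm)
  have h2 := congrArg norm h1
  rw [Complex.norm_exp] at h2
  simp at h2

end Torus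

/-! ### Stability of the ideal, and nilpotency of weights -/

section Orbits

variable {𝔤 : Type*} [LieRing 𝔤] [LieAlgebra ℂ 𝔤]

theorem adjointGroup_le_orbitStabilizer (x : 𝔤) : adjointGroup 𝔤 ≤ orbitStabilizer x := by
  intro γ hγ
  change γ • MulAction.orbit (adjointGroup 𝔤) x = MulAction.orbit (adjointGroup 𝔤) x
  exact MulAction.smul_orbit (⟨γ, hγ⟩ : adjointGroup 𝔤) x

/-- The diagonal action of `γ` as a linear map. -/
def diagonalMap (γ : fullAut 𝔤) : 𝔤 × 𝔤 →ₗ[ℂ] 𝔤 × 𝔤 :=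
  LinearMap.prodMap γ.1.toLinearMap γ.1.toLinearMap

theorem diagonalMap_apply (γ : fullAut 𝔤) (p : 𝔤 × 𝔤) : diagonalMap γ p = γ • p := rfl

theorem actOnFunctions_eq (γ : fullAut 𝔤) : actOnFunctions γ = pullback (diagonalMap γ⁻¹) := rfl

theorem diagonalMap_biscale (γ : fullAut 𝔤) (z t : ℂ) (p : 𝔤 × 𝔤) :
    diagonalMap γ (biscale z t p) = biscale z t (diagonalMap γ p) :=
  Prod.ext (map_smul γ.1 z p.1) (map_smul γ.1 t p.2)

theorem actOnFunctions_mem_bihomogeneous (γ : fullAut 𝔤) {d : ℕ × ℕ} {f : coordRing (𝔤 × 𝔤)}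
    (hf : f ∈ bihomogeneous d) : actOnFunctions γ f ∈ bihomogeneous d := by
  intro z t x y
  have h := hf z t (γ⁻¹ • x) (γ⁻¹ • y)
  have h' := diagonalMap_biscale γ⁻¹ z t (x, y)
  rw [actOnFunctions_eq, pullback_apply, pullback_apply]
  change f.1 (diagonalMap γ⁻¹ (biscale z t (x, y))) = _
  rw [h']
  exact h

theorem actOnFunctions_mul (γ δ : fullAut 𝔤) :
    actOnFunctions (γ * δ) = (actOnFunctions γ).comp (actOnFunctions δ) := by
  ext f p
  simp only [actOnFunctions_eq, AlgHom.comp_apply, pullback_apply, diagonalMap_apply, mul_inv_rev,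
    mul_smul]

theorem actOnFunctions_one : actOnFunctions (1 : fullAut 𝔤) = AlgHom.id ℂ _ := by
  ext f p
  simp only [actOnFunctions_eq, pullback_apply, diagonalMap_apply, inv_one, one_smul,
    AlgHom.id_apply]

theorem vanishingIdeal_orbitClosure (K : Subgroup (fullAut 𝔤)) (e : 𝔤 × 𝔤) :
    vanishingIdeal (orbitClosure K e) = vanishingIdeal (MulAction.orbit K e) :=
  vanishingIdeal_zariskiClosure _

variable (H : LieSubalgebra ℂ 𝔤) (K : Subgroup (fullAut 𝔤)) (e : 𝔤 × 𝔤)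

/-- The ideal defining the scheme-theoretic intersection. -/
abbrev intersectionIdeal : Ideal (coordRing (𝔤 × 𝔤)) :=
  vanishingIdeal (orbitClosure K e) ⊔ vanishingIdeal (doubled H)

variable {H K e}

theorem intersectionIdeal_le_comap_pullback {L : 𝔤 × 𝔤 →ₗ[ℂ] 𝔤 × 𝔤}
    (hK : ∀ p ∈ MulAction.orbit K e, L p ∈ MulAction.orbit K e)
    (hH : ∀ p ∈ doubled H, L p ∈ doubled H) :
    intersectionIdeal H K e ≤ (intersectionIdeal H K e).comap (pullback L) := by
  refine sup_le ?_ ?_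
  · intro f hf
    rw [vanishingIdeal_orbitClosure] at hf
    refine Ideal.mem_sup_left ?_
    rw [vanishingIdeal_orbitClosure]
    exact vanishingIdeal_le_comap_pullback L hK hf
  · intro f hf
    exact Ideal.mem_sup_right (vanishingIdeal_le_comap_pullback L hH hf)

/-- Bi-scaling commutes with the diagonal action, so the scaling axiom at `e` carries over to the
whole orbit. -/
theorem biscale_mem_orbit [FiniteDimensional ℂ 𝔤] (he : IsPrincipalNilpotentPair e)
    (hK : adjointGroup 𝔤 ≤ K) {z t : ℂ} (hz : z ≠ 0) (ht : t ≠ 0) {p : 𝔤 × 𝔤}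
    (hp : p ∈ MulAction.orbit K e) : biscale z t p ∈ MulAction.orbit K e := by
  obtain ⟨γ, rfl⟩ := hp
  obtain ⟨g, hg⟩ := he.exists_smul_eq (Units.mk0 z hz) (Units.mk0 t ht)
  refine ⟨γ * ⟨g.1, hK g.2⟩, ?_⟩
  change (γ * ⟨g.1, hK g.2⟩ : K) • e = biscale z t (diagonalMap γ.1 e)
  rw [← diagonalMap_biscale, mul_smul]
  exact congrArg (fun q => γ • q) hg

theorem intersectionIdeal_le_comap_biscale [FiniteDimensional ℂ 𝔤]
    (he : IsPrincipalNilpotentPair e) (hK : adjointGroup 𝔤 ≤ K) {z t : ℂ} (hz : z ≠ 0)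
    (ht : t ≠ 0) :
    intersectionIdeal H K e ≤ (intersectionIdeal H K e).comap (pullback (biscale z t)) :=
  intersectionIdeal_le_comap_pullback (fun _ hp => biscale_mem_orbit he hK hz ht hp)
    fun _ hp => ⟨H.smul_mem z hp.1, H.smul_mem t hp.2⟩

theorem charpoly_ad_smul [FiniteDimensional ℂ 𝔤] (γ : fullAut 𝔤) (x : 𝔤) :
    (LieAlgebra.ad ℂ 𝔤 (γ • x)).charpoly = (LieAlgebra.ad ℂ 𝔤 x).charpoly := by
  rw [← LinearEquiv.charpoly_conj γ.1 (LieAlgebra.ad ℂ 𝔤 x)]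
  congr 1
  ext y
  rw [LinearEquiv.conj_apply_apply]
  have h := fullAut_smul_lie γ x (γ⁻¹ • y)
  rw [smul_inv_smul] at h
  exact h.symm

/-- An element all of whose nonzero multiples are conjugate to it has a characteristic polynomial
without lower terms. -/
theorem charpoly_ad_coeff_eq_zero [FiniteDimensional ℂ 𝔤] {x : 𝔤}
    (hx : ∃ γ : fullAut 𝔤, γ • x = (2 : ℂ) • x) {k : ℕ} (hk : k < Module.finrank ℂ 𝔤) :
    (LieAlgebra.ad ℂ 𝔤 x).charpoly.coeff k = 0 := by
  obtain ⟨γ, hγ⟩ := hx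
  obtain ⟨j, hj⟩ := Nat.exists_eq_add_of_lt hk
  have h := charpoly_coeff_smul (LieAlgebra.ad ℂ 𝔤 : 𝔤 →ₗ[ℂ] Module.End ℂ 𝔤)
    (k := k) (j := j + 1) (by omega) 2 x
  have h' := congrArg (fun q => q.coeff k) (charpoly_ad_smul γ x)
  rw [hγ] at h'
  -- Homogeneity scales the coefficient by `2 ^ (j + 1)`, conjugacy leaves it unchanged; the
  -- exponent is positive as `k` is below the dimension.
  have h2 : ((2 : ℂ) ^ (j + 1) - 1) * (LieAlgebra.ad ℂ 𝔤 x).charpoly.coeff k = 0 := by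
    rw [sub_mul, one_mul, sub_eq_zero]
    exact h.symm.trans h'
  refine (mul_eq_zero.1 h2).resolve_left (sub_ne_zero.2 ?_)
  have : (1 : ℕ) < 2 ^ (j + 1) := Nat.one_lt_two_pow (by omega)
  exact_mod_cast this.ne'

/-- The functions on `𝔤 ⊕ 𝔤` given by the coefficients of the characteristic polynomial of
`ad (π p)`, for a linear map `π : 𝔤 ⊕ 𝔤 → 𝔤`. -/
def charpolyCoeffFn [FiniteDimensional ℂ 𝔤] (π : 𝔤 × 𝔤 →ₗ[ℂ] 𝔤) (k : ℕ) : coordRing (𝔤 × 𝔤) :=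
  ⟨_, charpoly_coeff_mem_coordRing ((LieAlgebra.ad ℂ 𝔤 : 𝔤 →ₗ[ℂ] Module.End ℂ 𝔤) ∘ₗ π) k⟩

theorem charpolyCoeffFn_apply [FiniteDimensional ℂ 𝔤] (π : 𝔤 × 𝔤 →ₗ[ℂ] 𝔤) (k : ℕ) (p : 𝔤 × 𝔤) :
    (charpolyCoeffFn π k).1 p = (LieAlgebra.ad ℂ 𝔤 (π p)).charpoly.coeff k := rfl

theorem charpolyCoeffFn_mem_vanishingIdeal [FiniteDimensional ℂ 𝔤] {π : 𝔤 × 𝔤 →ₗ[ℂ] 𝔤}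
    (hπ : ∀ (γ : fullAut 𝔤) (p : 𝔤 × 𝔤), π (γ • p) = γ • π p)
    (he : IsPrincipalNilpotentPair e) {k : ℕ} (hk : k < Module.finrank ℂ 𝔤) :
    charpolyCoeffFn π k ∈ vanishingIdeal (orbitClosure K e) := by
  rw [vanishingIdeal_orbitClosure]
  rintro _ ⟨γ, rfl⟩
  obtain ⟨g, hg⟩ := he.exists_smul_eq (Units.mk0 2 two_ne_zero) (Units.mk0 2 two_ne_zero)
  have h1 : π (γ.1 • e) = γ.1 • π e := hπ γ.1 e
  have h2 : g.1 • π e = (2 : ℂ) • π e := by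
    rw [← hπ, ← map_smul]
    exact congrArg π hg
  rw [charpolyCoeffFn_apply]
  change (LieAlgebra.ad ℂ 𝔤 (π (γ.1 • e))).charpoly.coeff k = 0
  rw [h1, charpoly_ad_smul]
  exact charpoly_ad_coeff_eq_zero ⟨g.1, h2⟩ hk

/-- The linear functions given on `H ⊕ H` by an eigenvalue of `ad` become nilpotent. -/
theorem mk_linearFn_pow_eq_zero [FiniteDimensional ℂ 𝔤] {π : 𝔤 × 𝔤 →ₗ[ℂ] 𝔤}
    (hπ : ∀ (γ : fullAut 𝔤) (p : 𝔤 × 𝔤), π (γ • p) = γ • π p)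
    (he : IsPrincipalNilpotentPair e) {χ : Module.Dual ℂ 𝔤} {v : 𝔤} (hv : v ≠ 0)
    (hχ : ∀ p ∈ doubled H, ⁅π p, v⁆ = χ (π p) • v) :
    DRing.mk H K e (linearFn (χ ∘ₗ π)) ^ Module.finrank ℂ 𝔤 = 0 := by
  set N := Module.finrank ℂ 𝔤
  let u := linearFn (χ ∘ₗ π)
  -- The characteristic equation of the eigenvalue, with its monic leading term split off; the
  -- remaining sum lies in the ideal of the orbit closure.
  have hH : u ^ N + ∑ k ∈ Finset.range N, charpolyCoeffFn π k * u ^ k ∈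
      vanishingIdeal (doubled H) := by
    refine mem_vanishingIdeal.2 fun p hp => ?_
    have hroot : (LieAlgebra.ad ℂ 𝔤 (π p)).charpoly.IsRoot (χ (π p)) :=
      (Module.End.hasEigenvalue_iff_isRoot_charpoly _ _).1
        (Module.End.hasEigenvalue_of_hasEigenvector
          (Module.End.hasEigenvector_iff.2 ⟨Module.End.mem_eigenspace_iff.2 (hχ p hp), hv⟩))
    rw [Polynomial.IsRoot, Polynomial.eval_eq_sum_range, LinearMap.charpoly_natDegree,
      Finset.sum_range_succ, add_comm] at hroot
    have hlead : (LieAlgebra.ad ℂ 𝔤 (π p)).charpoly.coeff N = 1 := by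
      have := (LinearMap.charpoly_monic (LieAlgebra.ad ℂ 𝔤 (π p))).coeff_natDegree
      rwa [LinearMap.charpoly_natDegree] at this
    rw [hlead, one_mul] at hroot
    rw [map_add, map_sum, map_pow]
    simp only [map_mul, map_pow]
    exact hroot
  have hsum : ∑ k ∈ Finset.range N, charpolyCoeffFn π k * u ^ k ∈
      vanishingIdeal (orbitClosure K e) :=
    Ideal.sum_mem _ fun k hk => Ideal.mul_mem_right _ _
      (charpolyCoeffFn_mem_vanishingIdeal hπ he (Finset.mem_range.1 hk))
  rw [← map_pow]
  refine Ideal.Quotient.eq_zero_iff_mem.2 ?_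
  have := sub_mem (Ideal.mem_sup_right (S := vanishingIdeal (orbitClosure K e)) hH)
    (Ideal.mem_sup_left (T := vanishingIdeal (doubled H)) hsum)
  rwa [add_sub_cancel_right] at this

end Orbits

/-! ### Finite-dimensionality -/

section Finiteness

variable {𝔤 : Type*} [LieRing 𝔤] [LieAlgebra ℂ 𝔤] [FiniteDimensional ℂ 𝔤]
  [LieAlgebra.IsKilling ℂ 𝔤] {H : LieSubalgebra ℂ 𝔤} [H.IsCartanSubalgebra]

omit [H.IsCartanSubalgebra] in
/-- The eigenvalues of `ad` span the dual space of a Cartan subalgebra. -/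
theorem span_eigenvalues_eq_top {n : ℕ} {b : Module.Basis (Fin n) ℂ 𝔤}
    {c : Fin n → Module.Dual ℂ H} (hbc : ∀ (i : Fin n) (h : H), ⁅(h : 𝔤), b i⁆ = c i h • b i) :
    Submodule.span ℂ (Set.range c) = ⊤ := by
  rw [eq_top_iff]
  rintro φ -
  -- An element killed by all weights is central in `𝔤`, hence zero.
  refine mem_span_of_iInf_ker_le_ker fun h hh => ?_
  have h0 : LieModule.toEnd ℂ 𝔤 𝔤 (h : 𝔤) = 0 := b.ext fun i => by
    have : c i h = 0 := (Submodule.mem_iInf _).1 hh i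
    rw [LieModule.toEnd_apply_apply, hbc, this, zero_smul, LinearMap.zero_apply]
  have h1 : h = 0 := Subtype.ext ((LieModule.toEnd_eq_zero_iff ℂ 𝔤 𝔤).1 h0)
  rw [h1]
  exact zero_mem _

omit [FiniteDimensional ℂ 𝔤] [LieAlgebra.IsKilling ℂ 𝔤] [H.IsCartanSubalgebra] in
-- Modulo `I(H ⊕ H)` only the restrictions of functionals to `H` matter, so any extension of the
-- weights to `𝔤` will do.
theorem mk_linearFn_eq_sum {K : Subgroup (fullAut 𝔤)} {e : 𝔤 × 𝔤} {n : ℕ} {π : 𝔤 × 𝔤 →ₗ[ℂ] 𝔤}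
    (hπ : ∀ p ∈ doubled H, π p ∈ H) {φ : Module.Dual ℂ 𝔤} {χ : Fin n → Module.Dual ℂ 𝔤}
    {a : Fin n → ℂ} (h : ∀ x ∈ H, φ x = ∑ i, a i * χ i x) :
    DRing.mk H K e (linearFn (φ ∘ₗ π)) = ∑ i, a i • DRing.mk H K e (linearFn (χ i ∘ₗ π)) := by
  simp only [← map_smul, ← map_sum]
  refine Ideal.Quotient.eq.2 (Ideal.mem_sup_right (mem_vanishingIdeal.2 fun p hp => ?_))
  rw [map_sub, map_sum, sub_eq_zero]
  simp only [map_smul]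
  exact h _ (hπ p hp)

omit [H.IsCartanSubalgebra] in
theorem mk_linearFn_mem_of_extension {K : Subgroup (fullAut 𝔤)} {e : 𝔤 × 𝔤} {n : ℕ}
    {b : Module.Basis (Fin n) ℂ 𝔤} {c : Fin n → Module.Dual ℂ H}
    (hbc : ∀ (i : Fin n) (h : H), ⁅(h : 𝔤), b i⁆ = c i h • b i)
    {χ : Fin n → Module.Dual ℂ 𝔤} (hχ : ∀ i x (hx : x ∈ H), χ i x = c i ⟨x, hx⟩)
    {π : 𝔤 × 𝔤 →ₗ[ℂ] 𝔤} (hπ : ∀ p ∈ doubled H, π p ∈ H) {S : Subalgebra ℂ (DRing H K e)}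
    (hS : ∀ i, DRing.mk H K e (linearFn (χ i ∘ₗ π)) ∈ S) (φ : Module.Dual ℂ 𝔤) :
    DRing.mk H K e (linearFn (φ ∘ₗ π)) ∈ S := by
  have hφ : φ ∘ₗ H.toSubmodule.subtype ∈ Submodule.span ℂ (Set.range c) := by
    rw [span_eigenvalues_eq_top hbc]
    trivial
  obtain ⟨a, ha⟩ := (Submodule.mem_span_range_iff_exists_fun ℂ).1 hφ
  rw [mk_linearFn_eq_sum (χ := χ) (a := a) hπ fun x hx => ?_]
  · exact S.sum_mem fun i _ => S.smul_mem (hS i) _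
  · have := LinearMap.congr_fun ha ⟨x, hx⟩
    simp only [LinearMap.sum_apply, LinearMap.smul_apply, smul_eq_mul, ← hχ _ x hx] at this
    exact this.symm

theorem finite_DRing {K : Subgroup (fullAut 𝔤)} {e : 𝔤 × 𝔤} (he : IsPrincipalNilpotentPair e) :
    Module.Finite ℂ (DRing H K e) := by
  obtain ⟨n, b, c, hbc⟩ := exists_eigenbasis H
  choose χ hχ using fun i => LinearMap.exists_extend (p := H.toSubmodule) (c i)
  have hχ' : ∀ i x (hx : x ∈ H), χ i x = c i ⟨x, hx⟩ := fun i x hx =>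
    LinearMap.congr_fun (hχ i) ⟨x, hx⟩
  let π : Bool → 𝔤 × 𝔤 →ₗ[ℂ] 𝔤 := fun s => bif s then LinearMap.fst ℂ 𝔤 𝔤 else LinearMap.snd ℂ 𝔤 𝔤
  have hπH : ∀ s, ∀ p ∈ doubled H, π s p ∈ H := by
    rintro (_ | _) p hp
    exacts [hp.2, hp.1]
  have hπ : ∀ s (γ : fullAut 𝔤) (p : 𝔤 × 𝔤), π s (γ • p) = γ • π s p := by
    rintro (_ | _) γ p <;> rfl
  let u : Bool × Fin n → DRing H K e := fun i => DRing.mk H K e (linearFn (χ i.2 ∘ₗ π i.1))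
  have hu : ∀ i, u i ^ Module.finrank ℂ 𝔤 = 0 := fun i =>
    mk_linearFn_pow_eq_zero (hπ i.1) he (b.ne_zero i.2) fun p hp => by
      rw [hχ' _ _ (hπH i.1 p hp)]
      exact hbc i.2 ⟨π i.1 p, hπH i.1 p hp⟩
  have hlin : ∀ s (φ : Module.Dual ℂ 𝔤),
      DRing.mk H K e (linearFn (φ ∘ₗ π s)) ∈ Algebra.adjoin ℂ (Set.range u) := fun s φ =>
    mk_linearFn_mem_of_extension hbc hχ' (hπH s)
      (fun i => Algebra.subset_adjoin (Set.mem_range_self (s, i))) φ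
  refine finite_quotient_of_nilpotent_generators hu fun φ => ?_
  have h : linearFn φ = linearFn ((φ ∘ₗ LinearMap.inl ℂ 𝔤 𝔤) ∘ₗ π true) +
      linearFn ((φ ∘ₗ LinearMap.inr ℂ 𝔤 𝔤) ∘ₗ π false) := by
    ext p
    simp [π, ← map_add]
  rw [h, map_add]
  exact add_mem (hlin true _) (hlin false _)

end Finiteness

/-! ### The Weyl group action -/

section WeylAction

variable {𝔤 : Type*} [LieRing 𝔤] [LieAlgebra ℂ 𝔤] {H : LieSubalgebra ℂ 𝔤}
  {K : Subgroup (fullAut 𝔤)} {e : 𝔤 × 𝔤}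

theorem intersectionIdeal_le_comap_actOnFunctions {γ : fullAut 𝔤} (hγ : γ ∈ K)
    (hH : ∀ x ∈ H, γ⁻¹ • x ∈ H) :
    intersectionIdeal H K e ≤ (intersectionIdeal H K e).comap (actOnFunctions γ) := by
  refine intersectionIdeal_le_comap_pullback ?_ fun p hp => ⟨hH _ hp.1, hH _ hp.2⟩
  rintro _ ⟨δ, rfl⟩
  refine ⟨⟨γ, hγ⟩⁻¹ * δ, ?_⟩
  exact mul_smul (⟨γ, hγ⟩⁻¹ : K) δ e

/-- The group `S` of automorphisms in `K` leaving `H` invariant acts on `DRing H K e`. -/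
def stableAction (S : Subgroup (fullAut 𝔤)) (hS : S ≤ K) (hH : ∀ γ ∈ S, ∀ x ∈ H, γ • x ∈ H) :
    S →* (DRing H K e ≃ₐ[ℂ] DRing H K e) := by
  let φ : S →* (DRing H K e →ₐ[ℂ] DRing H K e) :=
    { toFun := fun γ => Ideal.quotientMapₐ _ (actOnFunctions γ.1)
        (intersectionIdeal_le_comap_actOnFunctions (hS γ.2) (hH _ (S.inv_mem γ.2)))
      map_one' := by
        refine Ideal.Quotient.algHom_ext _ (AlgHom.ext fun f => ?_)
        exact congrArg (DRing.mk H K e) (AlgHom.congr_fun actOnFunctions_one f)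
      map_mul' := fun γ δ => by
        refine Ideal.Quotient.algHom_ext _ (AlgHom.ext fun f => ?_)
        exact congrArg (DRing.mk H K e) (AlgHom.congr_fun (actOnFunctions_mul γ.1 δ.1) f) }
  -- A monoid homomorphism from a group takes values in units, and the units among algebra
  -- endomorphisms are the automorphisms.
  exact (AlgEquiv.algHomUnitsEquiv ℂ (DRing H K e)).toMonoidHom.comp φ.toHomUnits

theorem mk_actOnFunctions_eq_self {γ : fullAut 𝔤} (hγ : ∀ x ∈ H, γ • x = x)
    (f : coordRing (𝔤 × 𝔤)) : DRing.mk H K e (actOnFunctions γ f) = DRing.mk H K e f := by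
  refine Ideal.Quotient.eq.2 (Ideal.mem_sup_right fun p hp => ?_)
  have h : diagonalMap γ⁻¹ p = p := Prod.ext
    (inv_smul_eq_iff.2 (hγ _ hp.1).symm) (inv_smul_eq_iff.2 (hγ _ hp.2).symm)
  change f.1 (diagonalMap γ⁻¹ p) - f.1 p = 0
  rw [h, sub_self]

theorem map_part_le {σ : DRing H K e ≃ₐ[ℂ] DRing H K e} {γ : fullAut 𝔤}
    (hσ : ∀ f, σ (DRing.mk H K e f) = DRing.mk H K e (actOnFunctions γ f)) (d : ℕ × ℕ) :
    (DRing.part H K e d).map σ.toLinearMap ≤ DRing.part H K e d := by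
  rintro _ ⟨_, ⟨f, hf, rfl⟩, rfl⟩
  exact ⟨_, actOnFunctions_mem_bihomogeneous γ hf, (hσ f).symm⟩

instance DRing.part_gradedMonoid : SetLike.GradedMonoid (DRing.part H K e) where
  one_mem := ⟨1, one_mem_bihomogeneous, map_one (DRing.mk H K e)⟩
  mul_mem := by
    rintro d d' _ _ ⟨f, hf, rfl⟩ ⟨g, hg, rfl⟩
    exact ⟨f * g, mul_mem_bihomogeneous hf hg, map_mul (DRing.mk H K e) f g⟩

variable [FiniteDimensional ℂ 𝔤] [LieAlgebra.IsKilling ℂ 𝔤] [H.IsCartanSubalgebra]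

/-- The action of the normalizer of the maximal torus on `DRing H K e`. -/
def normalizerAction (hK : adjointGroup 𝔤 ≤ K) :
    torusNormalizer H →* (DRing H K e ≃ₐ[ℂ] DRing H K e) :=
  (stableAction ((torusNormalizer H).map (adjointGroup 𝔤).subtype)
    (by rintro _ ⟨γ, _, rfl⟩; exact hK γ.2)
    (by rintro _ ⟨γ, hγ, rfl⟩ x hx; exact torusNormalizer_smul_mem hγ hx)).comp
    ((adjointGroup 𝔤).subtype.subgroupMap (torusNormalizer H))

theorem normalizerAction_mk (hK : adjointGroup 𝔤 ≤ K) (γ : torusNormalizer H)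
    (f : coordRing (𝔤 × 𝔤)) :
    normalizerAction (e := e) hK γ (DRing.mk H K e f) =
      DRing.mk H K e (actOnFunctions γ.1.1 f) := rfl

/-- The action of the Weyl group on `DRing H K e`. -/
def weylAction (hK : adjointGroup 𝔤 ≤ K) :
    WeylGroup H →* (DRing H K e ≃ₐ[ℂ] DRing H K e) :=
  QuotientGroup.lift _ (normalizerAction hK) fun γ hγ => by
    refine AlgEquiv.ext fun x => ?_
    obtain ⟨f, rfl⟩ := Ideal.Quotient.mkₐ_surjective ℂ _ x
    rw [normalizerAction_mk]
    exact mk_actOnFunctions_eq_self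
      (fun x hx => torus_smul_eq_self (Subgroup.mem_subgroupOf.1 hγ) hx) f

theorem weylAction_mk (hK : adjointGroup 𝔤 ≤ K) (γ : torusNormalizer H)
    (f : coordRing (𝔤 × 𝔤)) :
    weylAction (e := e) hK (QuotientGroup.mk γ) (DRing.mk H K e f) =
      DRing.mk H K e (actOnFunctions γ.1.1 f) := rfl

theorem map_part_weylAction_le (hK : adjointGroup 𝔤 ≤ K) (w : WeylGroup H) (d : ℕ × ℕ) :
    (DRing.part H K e d).map (weylAction (e := e) hK w).toLinearMap ≤ DRing.part H K e d := by
  induction w using QuotientGroup.induction_on with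
  | H γ => exact map_part_le (weylAction_mk hK γ) d

theorem map_part_weylAction (hK : adjointGroup 𝔤 ≤ K) (w : WeylGroup H) (d : ℕ × ℕ) :
    (DRing.part H K e d).map (weylAction (e := e) hK w).toLinearMap = DRing.part H K e d := by
  refine le_antisymm (map_part_weylAction_le hK w d) fun x hx => ?_
  refine ⟨weylAction hK w⁻¹ x, map_part_weylAction_le hK w⁻¹ d ⟨x, hx, rfl⟩, ?_⟩
  have h : weylAction (e := e) hK w * weylAction hK w⁻¹ = 1 := by
    rw [← map_mul, mul_inv_cancel, map_one]
  exact AlgEquiv.congr_fun h x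

end WeylAction

end NilpotentPair

end

theorem mainTheorem9 {𝔤 : Type*} [LieRing 𝔤] [LieAlgebra ℂ 𝔤] [FiniteDimensional ℂ 𝔤]
    [LieAlgebra.IsSimple ℂ 𝔤] (H : LieSubalgebra ℂ 𝔤) [H.IsCartanSubalgebra]
    (e : 𝔤 × 𝔤) (he : NilpotentPair.IsPrincipalNilpotentPair e)
    (K : Subgroup (NilpotentPair.fullAut 𝔤))
    (hK : K = NilpotentPair.orbitStabilizer e.1 ∨ K = NilpotentPair.orbitStabilizer e.2) :
    Module.Finite ℂ (NilpotentPair.DRing H K e) ∧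
    SetLike.GradedMonoid (NilpotentPair.DRing.part H K e) ∧
    DirectSum.IsInternal (NilpotentPair.DRing.part H K e) ∧
    ∃ ρ : NilpotentPair.WeylGroup H →*
        (NilpotentPair.DRing H K e ≃ₐ[ℂ] NilpotentPair.DRing H K e),
      (∀ (n : NilpotentPair.torusNormalizer H) (f : NilpotentPair.coordRing (𝔤 × 𝔤)),
        ρ (QuotientGroup.mk n) (NilpotentPair.DRing.mk H K e f) =
          NilpotentPair.DRing.mk H K e (NilpotentPair.actOnFunctions n.1.1 f)) ∧
      ∀ (w : NilpotentPair.WeylGroup H) (d : ℕ × ℕ),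
        (NilpotentPair.DRing.part H K e d).map (ρ w).toLinearMap =
          NilpotentPair.DRing.part H K e d := by
  have hG : NilpotentPair.adjointGroup 𝔤 ≤ K := by
    rcases hK with rfl | rfl <;> exact NilpotentPair.adjointGroup_le_orbitStabilizer _
  exact ⟨NilpotentPair.finite_DRing he, inferInstance,
    NilpotentPair.isInternal_map_bihomogeneous _
      (NilpotentPair.intersectionIdeal_le_comap_biscale he hG two_ne_zero three_ne_zero),
    NilpotentPair.weylAction hG, NilpotentPair.weylAction_mk hG,
    NilpotentPair.map_part_weylAction hG⟩
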